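/- Let $(K,\nu_0)$ be a valued field with value group $\Gamma_0$, and let $\Gamma$ be a totally ordered divisible abelian group containing $\Gamma_0$. Let $\mathcal V$ be the set consisting of $\nu_0$ and of all valuations $\nu:K[x]\to\Gamma\cup\{\infty\}$ extending $\nu_0$ (valuations may take the value $\infty$ at non-zero polynomials), partially ordered by declaring $\nu_0$ to be the smallest element and by $\nu\le\mu$ if and only if $\nu(f)\le\mu(f)$ for every $f\in K[x]$, for $\nu,\mu\in\mathcal V\setminus\{\nu_0\}$. The support of $\mu\in\mathcal V\setminus\{\nu_0\}$ is $\operatorname{supp}(\mu)=\{g\in K[x]\mid\mu(g)=\infty\}$. For $\nu\in\mathcal V\setminus\{\nu_0\}$ let $$\mathcal G_\nu=\bigoplus_{\gamma\in\nu(K[x]),\ \gamma<\infty}\{f\mid\nu(f)\ge\gamma\}/\{f\mid\nu(f)>\gamma\}$$ be its graded ring, with the multiplication induced by that of $K[x]$, and let $\mathrm{in}_\nu(f)\in\mathcal G_\nu$ be the class of $f$ in the summand of degree $\nu(f)$ if $\nu(f)<\infty$, and $\mathrm{in}_\nu(f)=0$ if $\nu(f)=\infty$. Theorem 1.1. Let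 $F\in K[x]$ be monic and irreducible, and let $\nu\in\mathcal V\setminus\{\nu_0\}$ be a valuation that is not a maximal element of $\mathcal V$. Then there exists a valuation $\mu\in\mathcal V\setminus\{\nu_0\}$ with $\operatorname{supp}(\mu)=(F)$ and $\nu\le\mu$ (that is, $\nu\in\mathcal V_F$) if and only if $\mathrm{in}_\nu(F)$ is not a unit of $\mathcal G_\nu$. -/

import Mathlib

open Polynomial

/-! Valuations are written additively: a valuation on a commutative ring `R` with values in
`Γ ∪ {∞}`, for an ordered abelian group `Γ`, is an `AddValuation R (WithTop Γ)`. -/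

section GradedRing

variable {R Γ : Type*} [CommRing R] [AddCommGroup Γ] [LinearOrder Γ] [IsOrderedAddMonoid Γ]

/-- The set of finite values `ν(R) \ {∞}`; it is an additive submonoid of `Γ`. -/
def valueMonoid (ν : AddValuation R (WithTop Γ)) : AddSubmonoid Γ where
  carrier := {γ | ∃ a : R, ν a = (γ : WithTop Γ)}
  zero_mem' := ⟨1, by simp⟩
  add_mem' := by
    rintro γ δ ⟨a, ha⟩ ⟨b, hb⟩
    exact ⟨a * b, by rw [ν.map_mul, ha, hb, WithTop.coe_add]⟩

/-- `𝒫_γ = {a ∈ R | ν(a) ≥ γ}`. -/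
def valGE (ν : AddValuation R (WithTop Γ)) (γ : Γ) : AddSubgroup R where
  carrier := {a | (γ : WithTop Γ) ≤ ν a}
  zero_mem' := by simp
  add_mem' := fun ha hb => ν.map_le_add ha hb
  neg_mem' := by
    intro a ha
    simpa [ν.map_neg] using ha

/-- `𝒫_γ⁺ = {a ∈ R | ν(a) > γ}`. -/
def valGT (ν : AddValuation R (WithTop Γ)) (γ : Γ) : AddSubgroup R where
  carrier := {a | (γ : WithTop Γ) < ν a}
  zero_mem' := by simp
  add_mem' := fun ha hb => ν.map_lt_add ha hb
  neg_mem' := by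
    intro a ha
    simpa [ν.map_neg] using ha

/-- The quotient group `𝒫_γ / 𝒫_γ⁺`. -/
abbrev gradedPiece (ν : AddValuation R (WithTop Γ)) (γ : Γ) : Type _ :=
  valGE ν γ ⧸ (valGT ν γ).addSubgroupOf (valGE ν γ)

/-- The class in `𝒫_γ / 𝒫_γ⁺` of an element `a ∈ 𝒫_γ`. -/
def pieceMk (ν : AddValuation R (WithTop Γ)) {γ : Γ} (a : valGE ν γ) : gradedPiece ν γ :=
  QuotientAddGroup.mk a

theorem valGE_mul_mem {ν : AddValuation R (WithTop Γ)} {γ δ : Γ} {a b : R}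
    (ha : a ∈ valGE ν γ) (hb : b ∈ valGE ν δ) : a * b ∈ valGE ν (γ + δ) := by
  change ((γ + δ : Γ) : WithTop Γ) ≤ ν (a * b)
  rw [ν.map_mul, WithTop.coe_add]
  exact add_le_add ha hb

theorem valGT_mul_mem {ν : AddValuation R (WithTop Γ)} {γ δ : Γ} {a b : R}
    (ha : a ∈ valGT ν γ) (hb : b ∈ valGE ν δ) : a * b ∈ valGT ν (γ + δ) := by
  change ((γ + δ : Γ) : WithTop Γ) < ν (a * b)
  rw [ν.map_mul, WithTop.coe_add]
  exact WithTop.add_lt_add_of_lt_of_le (WithTop.coe_ne_top) ha hb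

/-- Multiplication `𝒫_γ/𝒫_γ⁺ × 𝒫_δ/𝒫_δ⁺ → 𝒫_{γ+δ}/𝒫_{γ+δ}⁺`, induced by multiplication in `R`. -/
def pieceMul (ν : AddValuation R (WithTop Γ)) (γ δ : Γ) :
    gradedPiece ν γ →+ gradedPiece ν δ →+ gradedPiece ν (γ + δ) :=
  QuotientAddGroup.lift _
    { toFun := fun a => QuotientAddGroup.lift _
        { toFun := fun b =>
            (QuotientAddGroup.mk ⟨a.1 * b.1, valGE_mul_mem a.2 b.2⟩ : gradedPiece ν (γ + δ))
          map_zero' := by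
            rw [QuotientAddGroup.eq_zero_iff, AddSubgroup.mem_addSubgroupOf]
            simp [(valGT ν (γ + δ)).zero_mem]
          map_add' := fun b c => by
            rw [← QuotientAddGroup.mk_add]
            exact congrArg _ (Subtype.ext (mul_add _ _ _)) }
        (fun b hb => by
          rw [AddSubgroup.mem_addSubgroupOf] at hb
          change QuotientAddGroup.mk _ = 0
          rw [QuotientAddGroup.eq_zero_iff, AddSubgroup.mem_addSubgroupOf]
          have := valGT_mul_mem hb a.2
          rw [mul_comm, add_comm] at this
          exact this)
      map_zero' := by
        ext b
        change QuotientAddGroup.mk _ = 0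
        rw [QuotientAddGroup.eq_zero_iff, AddSubgroup.mem_addSubgroupOf]
        simp [(valGT ν (γ + δ)).zero_mem]
      map_add' := fun a c => by
        ext b
        exact congrArg (QuotientAddGroup.mk (s := (valGT ν (γ + δ)).addSubgroupOf _))
          (Subtype.ext (add_mul a.1 c.1 b.1)) }
    (fun a ha => by
      rw [AddSubgroup.mem_addSubgroupOf] at ha
      ext b
      change QuotientAddGroup.mk _ = 0
      rw [QuotientAddGroup.eq_zero_iff, AddSubgroup.mem_addSubgroupOf]
      exact valGT_mul_mem ha b.2)

theorem pieceMul_mk (ν : AddValuation R (WithTop Γ)) {γ δ : Γ} (a : valGE ν γ) (b : valGE ν δ) :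
    pieceMul ν γ δ (pieceMk ν a) (pieceMk ν b)
      = pieceMk ν ⟨a.1 * b.1, valGE_mul_mem a.2 b.2⟩ := rfl

/-- The summands of the graded ring, indexed by the finite values of `ν`. -/
abbrev gradedFamily (ν : AddValuation R (WithTop Γ)) (γ : valueMonoid ν) : Type _ :=
  gradedPiece ν (γ : Γ)

theorem gradedFamily_mk_eq (ν : AddValuation R (WithTop Γ)) {i j : valueMonoid ν} (h : i = j)
    (a : valGE ν (i : Γ)) (b : valGE ν (j : Γ)) (hab : (a : R) = b) :
    GradedMonoid.mk (A := gradedFamily ν) i (pieceMk ν a)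
      = GradedMonoid.mk (A := gradedFamily ν) j (pieceMk ν b) := by
  subst h
  rw [Subtype.ext hab]

theorem one_mem_valGE (ν : AddValuation R (WithTop Γ)) : (1 : R) ∈ valGE ν 0 := by
  change ((0 : Γ) : WithTop Γ) ≤ ν 1
  simp

theorem intCast_mem_valGE (ν : AddValuation R (WithTop Γ)) (n : ℤ) : (n : R) ∈ valGE ν 0 := by
  have := (valGE ν 0).zsmul_mem (one_mem_valGE ν) n
  simpa using this

theorem natCast_mem_valGE (ν : AddValuation R (WithTop Γ)) (n : ℕ) : (n : R) ∈ valGE ν 0 := by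
  simpa using intCast_mem_valGE ν n

instance gradedFamily.instGOne (ν : AddValuation R (WithTop Γ)) :
    GradedMonoid.GOne (gradedFamily ν) where
  one := pieceMk ν ⟨1, one_mem_valGE ν⟩

instance gradedFamily.instGMul (ν : AddValuation R (WithTop Γ)) :
    GradedMonoid.GMul (gradedFamily ν) where
  mul := fun {i j} a b => pieceMul ν i j a b

instance gradedFamily.instGCommRing (ν : AddValuation R (WithTop Γ)) :
    DirectSum.GCommRing (gradedFamily ν) where
  __ := gradedFamily.instGOne ν
  __ := gradedFamily.instGMul ν
  mul_zero := fun a => map_zero _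
  zero_mul := fun b => by
    change pieceMul ν _ _ 0 b = 0
    simp
  mul_add := fun a b c => map_add _ _ _
  add_mul := fun a b c => by
    change pieceMul ν _ _ (a + b) c = pieceMul ν _ _ a c + pieceMul ν _ _ b c
    simp
  one_mul := by
    rintro ⟨i, a⟩
    obtain ⟨a, rfl⟩ := QuotientAddGroup.mk_surjective a
    exact gradedFamily_mk_eq ν (zero_add i) _ _ (one_mul _)
  mul_one := by
    rintro ⟨i, a⟩
    obtain ⟨a, rfl⟩ := QuotientAddGroup.mk_surjective a
    exact gradedFamily_mk_eq ν (add_zero i) _ _ (mul_one _)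
  mul_assoc := by
    rintro ⟨i, a⟩ ⟨j, b⟩ ⟨k, c⟩
    obtain ⟨a, rfl⟩ := QuotientAddGroup.mk_surjective a
    obtain ⟨b, rfl⟩ := QuotientAddGroup.mk_surjective b
    obtain ⟨c, rfl⟩ := QuotientAddGroup.mk_surjective c
    exact gradedFamily_mk_eq ν (add_assoc i j k) _ _ (mul_assoc _ _ _)
  mul_comm := by
    rintro ⟨i, a⟩ ⟨j, b⟩
    obtain ⟨a, rfl⟩ := QuotientAddGroup.mk_surjective a
    obtain ⟨b, rfl⟩ := QuotientAddGroup.mk_surjective b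
    exact gradedFamily_mk_eq ν (add_comm i j) _ _ (mul_comm _ _)
  natCast := fun n => pieceMk ν ⟨n, natCast_mem_valGE ν n⟩
  natCast_zero := by
    refine (congrArg (pieceMk ν) (Subtype.ext ?_)).trans
      (QuotientAddGroup.mk_zero ((valGT ν 0).addSubgroupOf (valGE ν 0)))
    simp
  natCast_succ := fun n => by
    refine congrArg (pieceMk ν) (?_ : _ =
      (⟨n, natCast_mem_valGE ν n⟩ + ⟨1, one_mem_valGE ν⟩ : valGE ν 0))
    exact Subtype.ext (Nat.cast_succ n)
  intCast := fun n => pieceMk ν ⟨n, intCast_mem_valGE ν n⟩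
  intCast_ofNat := fun n => congrArg (pieceMk ν) (Subtype.ext (Int.cast_natCast n))
  intCast_negSucc_ofNat := fun n => by
    refine congrArg (pieceMk ν) (?_ : _ =
      (-⟨(n + 1 : ℕ), natCast_mem_valGE ν (n + 1)⟩ : valGE ν 0))
    exact Subtype.ext (Int.cast_negSucc n)

/-- The graded ring `gr_ν(R) = ⨁_{γ ∈ ν(R), γ < ∞} 𝒫_γ / 𝒫_γ⁺`; its commutative ring structure is
the one induced by the graded multiplication above. -/
abbrev gradedRing (ν : AddValuation R (WithTop Γ)) : Type _ :=
  DirectSum (valueMonoid ν) (gradedFamily ν)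

open Classical in
/-- The initial form `in_ν(a) ∈ gr_ν(R)`: the class of `a` in `𝒫_{ν(a)} / 𝒫_{ν(a)}⁺` if
`ν(a) < ∞`, and `0` if `ν(a) = ∞`. -/
noncomputable def initialForm (ν : AddValuation R (WithTop Γ)) (a : R) : gradedRing ν :=
  if h : ν a = ⊤ then 0
  else DirectSum.of (gradedFamily ν) ⟨(ν a).untop h, a, (WithTop.coe_untop _ h).symm⟩
    (pieceMk ν ⟨a, (WithTop.coe_untop _ h).le⟩)

end GradedRing

section Extensions

variable {K Γ : Type*} [Field K] [AddCommGroup Γ] [LinearOrder Γ] [IsOrderedAddMonoid Γ]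

/-- The valuations `ν : K[x] → Γ ∪ {∞}` extending the valuation `ν₀` on `K`. -/
structure ValExtension (ν₀ : AddValuation K (WithTop Γ)) where
  /-- the valuation on `K[x]` -/
  val : AddValuation K[X] (WithTop Γ)
  map_C : ∀ a : K, val (C a) = ν₀ a

/-- `ν ≤ μ` if and only if `ν(f) ≤ μ(f)` for every polynomial `f`. -/
instance (ν₀ : AddValuation K (WithTop Γ)) : PartialOrder (ValExtension ν₀) where
  le ν μ := ∀ f : K[X], ν.val f ≤ μ.val f
  le_refl _ _ := le_rfl
  le_trans _ _ _ h₁ h₂ f := (h₁ f).trans (h₂ f)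
  le_antisymm := by
    rintro ⟨ν, hν⟩ ⟨μ, hμ⟩ h₁ h₂
    have : ν = μ := AddValuation.ext fun f => le_antisymm (h₁ f) (h₂ f)
    subst this
    rfl

/-- The partially ordered set `𝒱`: all valuations on `K[x]` with values in `Γ ∪ {∞}` extending
`ν₀`, together with `ν₀` itself (the element `⊥`) as smallest element. -/
abbrev ValPoset (ν₀ : AddValuation K (WithTop Γ)) : Type _ :=
  WithBot (ValExtension ν₀)

/-- `𝒱_{F_∞}`: the valuations in `𝒱` (on `K[x]`) with support `(F)`. -/
def valuationsWithSupport (ν₀ : AddValuation K (WithTop Γ)) (F : K[X]) : Set (ValPoset ν₀) :=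
  {μ | ∃ μ' : ValExtension ν₀, μ = (μ' : ValPoset ν₀) ∧ μ'.val.supp = Ideal.span {F}}

/-- `𝒱_F`: the elements of `𝒱` bounded above by some valuation with support `(F)`. -/
def valuationsApproaching (ν₀ : AddValuation K (WithTop Γ)) (F : K[X]) : Set (ValPoset ν₀) :=
  {ν | ∃ μ ∈ valuationsWithSupport ν₀ F, ν ≤ μ}

end Extensions

/-! The valuations on `K[x]` with support `(F)` are the valuations on the field `L = K[x]/(F)`, so
the question is when `L` carries a valuation `w` with `w(f mod F) ≥ ν(f)` for all `f`.

The initial form of `F` is a unit if and only if `ν(1 - F g) > 0` for some `g`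
(`isUnit_initialForm_iff`). Such a `g` is an obstruction: `1 = (1 - F g) + F g` would have positive
`w`-value. It is the only obstruction, by Chevalley's theorem on the existence of dominating
valuation rings, applied in the fraction field of the group algebra `L[Γ]`
(`exists_valuation_of_map_ne_one`). The variables `t^γ` of the group algebra record the elements of
`Γ`, so that the value group of the resulting valuation contains `Γ` and its values on `L` can be
compared with those of `ν`.

That valuation takes its values on `L` in `Γ` itself: it agrees with `ν₀` on `K`, since inequalities
at `a` and at `a⁻¹` force equality, and `L` is algebraic over `K`, so that the values on `L` are
torsion modulo those on `K` (`Valuation.exists_pow_eq_of_isAlgebraic`), while `Γ` is divisible. -/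

/-! ### Units among the initial forms -/

section InitialForm

variable {R Γ : Type*} [CommRing R] [AddCommGroup Γ] [LinearOrder Γ] [IsOrderedAddMonoid Γ]

theorem pieceMk_eq_iff (ν : AddValuation R (WithTop Γ)) {γ : Γ} (a b : valGE ν γ) :
    pieceMk ν a = pieceMk ν b ↔ (γ : WithTop Γ) < ν ((b : R) - a) := by
  refine QuotientAddGroup.eq.trans ?_
  rw [AddSubgroup.mem_addSubgroupOf]
  change _ < ν (-(a : R) + b) ↔ _
  rw [neg_add_eq_sub]

theorem initialForm_of_eq_coe (ν : AddValuation R (WithTop Γ)) {a : R} (i : valueMonoid ν)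
    (h : ν a = ((i : Γ) : WithTop Γ)) :
    initialForm ν a = DirectSum.of (gradedFamily ν) i (pieceMk ν ⟨a, h.ge⟩) := by
  have htop : ν a ≠ ⊤ := by simp [h]
  rw [initialForm, dif_neg htop]
  refine DirectSum.of_eq_of_gradedMonoid_eq (gradedFamily_mk_eq ν ?_ _ _ rfl)
  apply Subtype.ext
  simp [h]

/-- The degree zero component of a multiple of `in_ν(a)` is the class of some `a * b`. -/
theorem exists_initialForm_mul_apply_zero (ν : AddValuation R (WithTop Γ)) (a : R)
    (u : gradedRing ν) :
    ∃ (b : R) (h : a * b ∈ valGE ν ((0 : valueMonoid ν) : Γ)),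
      (initialForm ν a * u) 0 = pieceMk ν ⟨a * b, h⟩ := by
  have hzero : (0 : gradedRing ν) 0
      = pieceMk ν ⟨a * 0, by rw [mul_zero]; exact zero_mem _⟩ := by
    simp only [mul_zero]
    rfl
  -- If `ν a = ⊤` or if the degrees of the factors do not add up to zero, the component vanishes and
  -- `b = 0` works.
  by_cases ha : ν a = ⊤
  · exact ⟨0, _, by rw [initialForm, dif_pos ha, zero_mul]; exact hzero⟩
  obtain ⟨γ, hγ⟩ := WithTop.ne_top_iff_exists.mp ha
  rw [initialForm_of_eq_coe ν ⟨γ, a, hγ.symm⟩ hγ.symm]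
  induction u using DirectSum.induction_on with
  | zero => exact ⟨0, _, by rw [mul_zero]; exact hzero⟩
  | of j c =>
    obtain ⟨c, rfl⟩ := QuotientAddGroup.mk_surjective c
    rw [DirectSum.of_mul_of]
    by_cases hj : (⟨γ, a, hγ.symm⟩ + j : valueMonoid ν) = 0
    · have hmem := valGE_mul_mem (ν := ν) (γ := γ) hγ.le c.2
      have hj' : γ + (j : Γ) = ((0 : valueMonoid ν) : Γ) := congrArg Subtype.val hj
      rw [hj'] at hmem
      refine ⟨c, hmem, ?_⟩
      rw [← DirectSum.of_eq_same (β := gradedFamily ν) 0 (pieceMk ν ⟨a * c, hmem⟩)]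
      exact DFunLike.congr_fun (DirectSum.of_eq_of_gradedMonoid_eq
        (gradedFamily_mk_eq ν hj ⟨a * c, valGE_mul_mem hγ.le c.2⟩ ⟨a * c, hmem⟩ rfl)) 0
    · exact ⟨0, _, by rw [DirectSum.of_eq_of_ne _ _ _ (Ne.symm hj)]; exact hzero⟩
  | add u v hu hv =>
    obtain ⟨b, hb, hb'⟩ := hu
    obtain ⟨c, hc, hc'⟩ := hv
    refine ⟨b + c, by rw [mul_add]; exact add_mem hb hc, ?_⟩
    rw [mul_add, DirectSum.add_apply, hb', hc']
    refine congrArg (pieceMk ν) (Subtype.ext ?_ : (⟨a * b, hb⟩ + ⟨a * c, hc⟩ : valGE ν _) = _)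
    exact (mul_add a b c).symm

/-- The initial form of `a` is a unit exactly when some multiple of `a` is congruent to `1` modulo
elements of positive value. -/
theorem isUnit_initialForm_iff (ν : AddValuation R (WithTop Γ)) (a : R) :
    IsUnit (initialForm ν a) ↔ ∃ b : R, 0 < ν (1 - a * b) := by
  constructor
  · intro h
    obtain ⟨u, hu⟩ := h.exists_right_inv
    obtain ⟨b, hb, hb'⟩ := exists_initialForm_mul_apply_zero ν a u
    refine ⟨b, ?_⟩
    have h1 : (1 : gradedRing ν) 0 = pieceMk ν ⟨1, one_mem_valGE ν⟩ :=
      DirectSum.of_eq_same (β := gradedFamily ν) 0 _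
    rw [hu, h1] at hb'
    have := (pieceMk_eq_iff ν (⟨a * b, hb⟩ : valGE ν (0 : Γ)) ⟨1, one_mem_valGE ν⟩).mp hb'.symm
    exact this
  · rintro ⟨b, hb⟩
    have hab : ν (a * b) = 0 := by
      have := ν.map_eq_of_lt_sub (x := 1) (y := a * b) (by
        rw [ν.map_one, ν.map_sub_swap]; exact hb)
      rw [this, ν.map_one]
    have hsum := hab
    rw [ν.map_mul] at hsum
    have ha : ν a ≠ ⊤ := fun h => by simp [h] at hsum
    have hb' : ν b ≠ ⊤ := fun h => by simp [h] at hsum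
    obtain ⟨γ, hγ⟩ := WithTop.ne_top_iff_exists.mp ha
    obtain ⟨δ, hδ⟩ := WithTop.ne_top_iff_exists.mp hb'
    have hγδ : γ + δ = 0 := by
      rw [← hγ, ← hδ] at hsum
      exact_mod_cast hsum
    refine IsUnit.of_mul_eq_one (initialForm ν b) ?_
    rw [initialForm_of_eq_coe ν ⟨γ, a, hγ.symm⟩ hγ.symm,
      initialForm_of_eq_coe ν ⟨δ, b, hδ.symm⟩ hδ.symm, DirectSum.of_mul_of]
    have hmem : a * b ∈ valGE ν 0 := hab.ge
    refine (DirectSum.of_eq_of_gradedMonoid_eq (gradedFamily_mk_eq ν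
      (Subtype.ext hγδ : (⟨γ, a, hγ.symm⟩ + ⟨δ, b, hδ.symm⟩ : valueMonoid ν) = 0)
      ⟨a * b, valGE_mul_mem hγ.le hδ.le⟩ ⟨a * b, hmem⟩ rfl)).trans ?_
    refine congrArg (DirectSum.of (gradedFamily ν) 0) (?_ : pieceMk ν _ = pieceMk ν _)
    exact (pieceMk_eq_iff ν (⟨a * b, hmem⟩ : valGE ν (0 : Γ)) ⟨1, one_mem_valGE ν⟩).mpr hb

end InitialForm

/-! ### Valuations on algebraic extensions with values in a given group -/

section ValuedGroup

variable {L G₀ Γ : Type*} [Field L] [LinearOrderedCommGroupWithZero G₀]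
  [AddCommGroup Γ] [LinearOrder Γ] [IsOrderedAddMonoid Γ]

/-- A valuation on a field whose nonzero values all lie in the image of an order-reversing embedding
of `Γ` can be written additively, with values in `Γ ∪ {∞}`. Strict inequalities are used because
for trivial `Γ` the inequalities `γ ≤ w x` with `γ : Γ` do not tell `0` from `∞`. -/
theorem exists_addValuation_of_strictAnti (v : Valuation L G₀) (ι : Multiplicative Γ →* G₀)
    (hι : StrictAnti fun γ : Γ => ι (.ofAdd γ))
    (hv : ∀ x : L, x ≠ 0 → ∃ γ : Γ, v x = ι (.ofAdd γ)) :
    ∃ w : AddValuation L (WithTop Γ), ∀ (x : L) (γ : Γ), (γ : WithTop Γ) < w x ↔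
      v x < ι (.ofAdd γ) := by
  classical
  choose g hg using hv
  set f : L → WithTop Γ := fun x => if h : x = 0 then ⊤ else (g x h : WithTop Γ) with hf
  have hne : ∀ γ : Γ, ι (.ofAdd γ) ≠ 0 := fun γ =>
    ((Group.isUnit (Multiplicative.ofAdd γ)).map ι).ne_zero
  have key : ∀ (x : L) (γ : Γ), (γ : WithTop Γ) < f x ↔ v x < ι (.ofAdd γ) := by
    intro x γ
    by_cases h : x = 0
    · simp only [hf, h, dite_true, map_zero, WithTop.coe_lt_top, true_iff]
      exact zero_lt_iff.mpr (hne γ)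
    · simp only [hf, h, dite_false, hg x h, WithTop.coe_lt_coe]
      exact hι.lt_iff_gt.symm
  have feq : ∀ (x : L) (γ : Γ), v x = ι (.ofAdd γ) → f x = γ := by
    intro x γ h
    have hx : x ≠ 0 := by
      rintro rfl
      rw [map_zero] at h
      exact hne γ h.symm
    simp only [hf, hx, dite_false, WithTop.coe_inj]
    exact hι.injective ((hg x hx).symm.trans h)
  refine ⟨AddValuation.of f (by simp [hf]) (feq 1 0 (by simp)) ?_ ?_, key⟩
  · intro x y
    refine le_of_forall_lt fun c hc => ?_
    lift c to Γ using ((hc.trans_le (min_le_left _ _)).trans_le le_top).ne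
    rw [lt_min_iff, key, key] at hc
    exact (key _ _).mpr (v.map_add_lt hc.1 hc.2)
  · intro x y
    by_cases hx : x = 0
    · simp [hf, hx]
    by_cases hy : y = 0
    · simp [hf, hy]
    rw [feq x _ (hg x hx), feq y _ (hg y hy), ← WithTop.coe_add]
    exact feq _ _ (by rw [map_mul, hg x hx, hg y hy, ofAdd_add, map_mul])

/-- Over a field `K`, the value of an algebraic element is torsion modulo the values of `K`: in an
algebraic relation, two distinct terms must have the same value. -/
theorem Valuation.exists_pow_eq_of_isAlgebraic {K : Type*} [Field K] [Algebra K L]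
    (v : Valuation L G₀) {x : L} (hx : x ≠ 0) (halg : IsAlgebraic K x) :
    ∃ (n : ℕ) (a : K), n ≠ 0 ∧ a ≠ 0 ∧ v x ^ n = v (algebraMap K L a) := by
  classical
  obtain ⟨p, hp, hpx⟩ := halg
  set t : ℕ → L := fun i => algebraMap K L (p.coeff i) * x ^ i with ht
  have hsum : ∑ i ∈ p.support, t i = 0 := by
    rw [← hpx, aeval_def, eval₂_eq_sum, sum_def]
  have hne : p.support.Nonempty := by simpa using hp
  obtain ⟨j, hj, hmax⟩ := p.support.exists_max_image (fun i => v (t i)) hne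
  have htj : ∀ i ∈ p.support, t i ≠ 0 := fun i hi =>
    mul_ne_zero ((_root_.map_ne_zero _).mpr (mem_support_iff.mp hi)) (pow_ne_zero _ hx)
  obtain ⟨i, hi, hij, heq⟩ : ∃ i ∈ p.support, i ≠ j ∧ v (t i) = v (t j) := by
    by_contra! hcon
    have := v.map_sum_eq_of_lt hj (f := t) fun i hi => by
      rw [Finset.mem_sdiff, Finset.mem_singleton] at hi
      exact lt_of_le_of_ne (hmax i hi.1) (hcon i hi.1 hi.2)
    rw [hsum, map_zero] at this
    exact htj j hj ((map_eq_zero v).mp this.symm)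
  clear hmax hsum
  wlog hlt : i < j generalizing i j
  · exact this i hi j hj hij.symm heq.symm (lt_of_le_of_ne (not_lt.mp hlt) hij.symm)
  refine ⟨j - i, p.coeff i / p.coeff j, by omega,
    div_ne_zero (mem_support_iff.mp hi) (mem_support_iff.mp hj), ?_⟩
  obtain ⟨k, rfl⟩ := Nat.exists_eq_add_of_lt hlt
  have hvx : v x ^ i ≠ 0 := pow_ne_zero _ ((_root_.map_ne_zero v).mpr hx)
  have hvj : v (algebraMap K L (p.coeff (i + k + 1))) ≠ 0 :=
    (_root_.map_ne_zero v).mpr ((_root_.map_ne_zero _).mpr (mem_support_iff.mp hj))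
  simp only [ht, map_mul, map_pow] at heq
  rw [map_div₀, map_div₀, eq_div_iff hvj, show i + k + 1 - i = k + 1 by omega]
  apply mul_right_cancel₀ hvx
  rw [mul_assoc, mul_comm (v _) (v x ^ i), ← mul_assoc, ← pow_add, heq, mul_comm]
  congr 2
  omega

end ValuedGroup

/-! ### Subgroups of the group algebra -/

section GroupAlgebra

variable {L Γ : Type*} [CommRing L] [AddCommGroup Γ]

/-- The elements of the group algebra `L[Γ]` whose coefficient in each degree `γ` lies in a given
subgroup `N γ` of `L`. -/
def coeffSubgroup (N : Γ → AddSubgroup L) : AddSubgroup (AddMonoidAlgebra L Γ) where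
  carrier := {p | ∀ γ, p.coeff γ ∈ N γ}
  zero_mem' := fun _ => zero_mem _
  add_mem' := fun hp hq γ => add_mem (hp γ) (hq γ)
  neg_mem' := fun hp γ => neg_mem (hp γ)

theorem single_mem_coeffSubgroup (N : Γ → AddSubgroup L) {γ : Γ} {a : L} (ha : a ∈ N γ) :
    AddMonoidAlgebra.single γ a ∈ coeffSubgroup N := by
  classical
  intro δ
  rw [AddMonoidAlgebra.coeff_single, Finsupp.single_apply]
  split_ifs with h
  · exact h ▸ ha
  · exact zero_mem _

theorem mul_mem_coeffSubgroup {N N' N'' : Γ → AddSubgroup L}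
    (h : ∀ γ δ a b, a ∈ N γ → b ∈ N' δ → a * b ∈ N'' (γ + δ)) {p q : AddMonoidAlgebra L Γ}
    (hp : p ∈ coeffSubgroup N) (hq : q ∈ coeffSubgroup N') : p * q ∈ coeffSubgroup N'' := by
  rw [AddMonoidAlgebra.mul_def]
  exact sum_mem fun γ _ => sum_mem fun δ _ =>
    single_mem_coeffSubgroup N'' (h γ δ _ _ (hp γ) (hq δ))

end GroupAlgebra

/-! ### Domination by a valuation in a larger group -/

section Chevalley

universe u v w

variable {R : Type u} {L : Type v} {Γ : Type w} [CommRing R] [Field L]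
  [AddCommGroup Γ] [LinearOrder Γ] [IsOrderedAddMonoid Γ]

/-- Let `ν` be a valuation on `R` and `π : R → L` a homomorphism to a field such that no element of
positive value maps to `1`. Then `L` carries a valuation `v`, in a group containing `Γ`, such that
the value of `π f` is at least that of `f`. The values are written multiplicatively, so that the
embedding `ι` of `Γ` reverses the order.

In the group algebra `L[Γ]`, the monomials `π(f) t^γ` with `ν(f) ≥ γ` span a subring in which those
with `ν(f) > γ` span a proper ideal; `v` is induced by a valuation ring of the fraction field of
`L[Γ]` dominating them, and `ι(γ)` is the value of `t^(-γ)`. -/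
theorem exists_valuation_of_map_ne_one (ν : AddValuation R (WithTop Γ)) (π : R →+* L)
    (h : ∀ f, 0 < ν f → π f ≠ 1) :
    ∃ (G₀ : Type (max v w)) (_ : LinearOrderedCommGroupWithZero G₀) (v : Valuation L G₀)
      (ι : Multiplicative Γ →* G₀), StrictAnti (fun γ : Γ => ι (.ofAdd γ)) ∧
      (∀ (f : R) (γ : Γ), (γ : WithTop Γ) ≤ ν f → v (π f) ≤ ι (.ofAdd γ)) ∧
      (∀ (f : R) (γ : Γ), (γ : WithTop Γ) < ν f → v (π f) < ι (.ofAdd γ)) := by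
  classical
  let N : Γ → AddSubgroup L := fun γ => (valGE ν γ).map π.toAddMonoidHom
  let N' : Γ → AddSubgroup L := fun γ => (valGT ν γ).map π.toAddMonoidHom
  have hN : ∀ γ δ a b, a ∈ N γ → b ∈ N δ → a * b ∈ N (γ + δ) := by
    rintro γ δ _ _ ⟨f, hf, rfl⟩ ⟨g, hg, rfl⟩
    exact ⟨f * g, valGE_mul_mem hf hg, map_mul π f g⟩
  have hN' : ∀ γ δ a b, a ∈ N γ → b ∈ N' δ → a * b ∈ N' (γ + δ) := by
    rintro γ δ _ _ ⟨f, hf, rfl⟩ ⟨g, hg, rfl⟩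
    refine ⟨f * g, ?_, map_mul π f g⟩
    rw [mul_comm, add_comm]
    exact valGT_mul_mem hg hf
  let A := AddMonoidAlgebra L Γ
  let M := FractionRing A
  let B : Subring A :=
    { coeffSubgroup N with
      one_mem' := single_mem_coeffSubgroup N (γ := 0) ⟨1, one_mem_valGE ν, map_one π⟩
      mul_mem' := mul_mem_coeffSubgroup hN }
  let I : Ideal B :=
    { carrier := {p | (p : A) ∈ coeffSubgroup N'}
      zero_mem' := zero_mem (coeffSubgroup N')
      add_mem' := fun hp hq => (coeffSubgroup N').add_mem hp hq
      smul_mem' := fun c p hp => mul_mem_coeffSubgroup hN' c.2 hp }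
  have hI : I ≠ ⊤ := by
    rw [Ideal.ne_top_iff_one]
    intro h1
    obtain ⟨f, hf, hf1⟩ := h1 0
    refine h f hf (hf1.trans ?_)
    exact AddMonoidAlgebra.coeff_one_zero
  let e : A →+* M := algebraMap A M
  have he : Function.Injective e := IsFractionRing.injective A M
  let eB : B ≃+* B.map e := B.equivMapOfInjective e he
  obtain ⟨O, hsub, hnonunits⟩ := Ideal.image_subset_nonunits_valuationSubring
    (I.comap eB.symm.toRingHom) (Ideal.comap_ne_top _ hI)
  have hB : ∀ p ∈ coeffSubgroup N, O.valuation (e p) ≤ 1 := fun p hp =>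
    (O.valuation_le_one_iff _).mpr (hsub ⟨p, hp, rfl⟩)
  have hI' : ∀ p (_ : p ∈ coeffSubgroup N), p ∈ coeffSubgroup N' → O.valuation (e p) < 1 := by
    intro p hp hp'
    rw [← O.mem_nonunits_iff]
    refine hnonunits ⟨eB ⟨p, hp⟩, ?_, rfl⟩
    change eB.symm (eB ⟨p, hp⟩) ∈ I
    rw [eB.symm_apply_apply]
    exact hp'
  let ι : Multiplicative Γ →* O.ValueGroup :=
    (O.valuation.toMonoidWithZeroHom.toMonoidHom.comp e.toMonoidHom).comp
      { toFun := fun γ => AddMonoidAlgebra.single (-γ.toAdd) (1 : L)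
        map_one' := by rw [toAdd_one, neg_zero, ← AddMonoidAlgebra.one_def]
        map_mul' := fun a b => by
          rw [AddMonoidAlgebra.single_mul_single, toAdd_mul, neg_add, mul_one] }
  have hι : ∀ γ : Γ, ι (.ofAdd γ) = O.valuation (e (AddMonoidAlgebra.single (-γ) 1)) :=
    fun _ => rfl
  have hpos : ∀ γ, 0 < ι γ := fun γ => zero_lt_iff.mpr ((Group.isUnit γ).map ι).ne_zero
  have hsingle : ∀ (γ : Γ) (a : L), O.valuation (e (AddMonoidAlgebra.single γ a)) *
      ι (.ofAdd γ) = O.valuation (e (AddMonoidAlgebra.single 0 a)) := by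
    intro γ a
    rw [hι, ← map_mul, ← map_mul, AddMonoidAlgebra.single_mul_single, add_neg_cancel, mul_one]
  have hle : ∀ (f : R) (γ : Γ), (γ : WithTop Γ) ≤ ν f →
      O.valuation (e (AddMonoidAlgebra.single 0 (π f))) ≤ ι (.ofAdd γ) := by
    intro f γ hf
    rw [← hsingle γ]
    exact mul_le_of_le_one_left' (hB _ (single_mem_coeffSubgroup N ⟨f, hf, rfl⟩))
  have hlt : ∀ (f : R) (γ : Γ), (γ : WithTop Γ) < ν f →
      O.valuation (e (AddMonoidAlgebra.single 0 (π f))) < ι (.ofAdd γ) := by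
    intro f γ hf
    rw [← hsingle γ]
    refine mul_lt_of_lt_one_left (hpos _) (hI' _ (single_mem_coeffSubgroup N ⟨f, hf.le, rfl⟩)
      (single_mem_coeffSubgroup N' ⟨f, hf, rfl⟩))
  refine ⟨O.ValueGroup, inferInstance,
    O.valuation.comap (e.comp AddMonoidAlgebra.singleZeroRingHom), ι, ?_, hle, hlt⟩
  intro γ δ hγδ
  have h1 := hlt 1 (γ - δ) (by rw [ν.map_one]; exact_mod_cast sub_neg.mpr hγδ)
  rw [map_one, ← AddMonoidAlgebra.one_def, map_one, map_one] at h1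
  calc ι (.ofAdd δ) = 1 * ι (.ofAdd δ) := (one_mul _).symm
    _ < ι (.ofAdd (γ - δ)) * ι (.ofAdd δ) := mul_lt_mul_of_pos_right h1 (hpos _)
    _ = ι (.ofAdd γ) := by rw [← map_mul, ← ofAdd_add, sub_add_cancel]

end Chevalley

/-! ### Valuations with support generated by an irreducible polynomial -/

section Extension

variable {K Γ : Type*} [Field K] [AddCommGroup Γ] [LinearOrder Γ] [IsOrderedAddMonoid Γ]
  {ν₀ : AddValuation K (WithTop Γ)}

/-- On constants, a valuation above `ν` must equal `ν₀`: it is at least `ν₀` at both `a` and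
`a⁻¹`. -/
theorem ValExtension.map_C_eq_of_le {ν : ValExtension ν₀} {w : AddValuation K[X] (WithTop Γ)}
    (h : ∀ f, ν.val f ≤ w f) (a : K) : w (C a) = ν₀ a := by
  rcases eq_or_ne a 0 with rfl | ha
  · simp
  have h1 := h (C a)
  have h2 := h (C a⁻¹)
  rw [ν.map_C] at h1 h2
  have h3 : w (C a) + w (C a⁻¹) = 0 := by
    rw [← w.map_mul, ← C_mul, mul_inv_cancel₀ ha, C_1, w.map_one]
  have h4 : ν₀ a + ν₀ a⁻¹ = 0 := by rw [← ν₀.map_mul, mul_inv_cancel₀ ha, ν₀.map_one]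
  refine le_antisymm ?_ h1
  by_contra! hlt
  have htop : ν₀ a⁻¹ ≠ ⊤ := fun ht => by simp [ht] at h4
  have := WithTop.add_lt_add_of_lt_of_le htop hlt h2
  rw [h3, h4] at this
  exact this.false

/-- If no multiple of `F` is congruent to `1` modulo elements of positive `ν`-value, then the
field `K[x]/(F)` carries a `Γ`-valued valuation whose pullback to `K[x]` is above `ν`. -/
theorem ValExtension.exists_le_supp_eq_span [DivisibleBy Γ ℕ] (ν : ValExtension ν₀) {F : K[X]}
    (hirr : Irreducible F) (h : ∀ g : K[X], ν.val (1 - F * g) ≤ 0) :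
    ∃ μ : ValExtension ν₀, μ.val.supp = Ideal.span {F} ∧ ν ≤ μ := by
  have : Fact (Irreducible F) := ⟨hirr⟩
  have : Module.Finite K (AdjoinRoot F) := (AdjoinRoot.powerBasis hirr.ne_zero).finite
  obtain ⟨G₀, _, v, ι, hι, hle, hlt⟩ :=
    exists_valuation_of_map_ne_one ν.val (AdjoinRoot.mk F) fun f hf hf1 => by
      rw [← map_one (AdjoinRoot.mk F), AdjoinRoot.mk_eq_mk] at hf1
      obtain ⟨g, hg⟩ := hf1
      have := h (-g)
      rw [mul_neg, ← hg, sub_neg_eq_add, add_sub_cancel] at this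
      exact hf.not_ge this
  have hK : ∀ a : K, a ≠ 0 → ∃ γ : Γ, v (algebraMap K (AdjoinRoot F) a) = ι (.ofAdd γ) := by
    intro a ha
    obtain ⟨γ, hγ⟩ := WithTop.ne_top_iff_exists.mp (ν₀.ne_top_iff.mpr ha)
    have hγ' : ((-γ : Γ) : WithTop Γ) = ν₀ a⁻¹ := by
      rw [ν₀.map_inv, ← hγ]
      rfl
    refine ⟨γ, le_antisymm (hle (C a) γ (by rw [ν.map_C, hγ])) ?_⟩
    have h1 := hle (C a⁻¹) (-γ) (by rw [ν.map_C, hγ'])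
    have h2 : v (AdjoinRoot.mk F (C a⁻¹)) * v (algebraMap K (AdjoinRoot F) a) = 1 := by
      rw [← map_mul, AdjoinRoot.algebraMap_eq, AdjoinRoot.mk_C, ← map_mul, inv_mul_cancel₀ ha,
        map_one, map_one]
    calc ι (.ofAdd γ) = ι (.ofAdd γ) * (v (AdjoinRoot.mk F (C a⁻¹)) *
          v (algebraMap K (AdjoinRoot F) a)) := by rw [h2, mul_one]
      _ ≤ ι (.ofAdd γ) * (ι (.ofAdd (-γ)) * v (algebraMap K (AdjoinRoot F) a)) := by gcongr
      _ = v (algebraMap K (AdjoinRoot F) a) := by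
        rw [← mul_assoc, ← map_mul, ← ofAdd_add, add_neg_cancel, ofAdd_zero, map_one, one_mul]
  -- The values of `AdjoinRoot F` are torsion over those of `K`, so lie in the divisible group `Γ`.
  obtain ⟨w, hw⟩ := exists_addValuation_of_strictAnti v ι hι fun x hx => by
    obtain ⟨n, a, hn, ha, hna⟩ := v.exists_pow_eq_of_isAlgebraic hx
      (Algebra.IsAlgebraic.isAlgebraic (R := K) x)
    obtain ⟨γ, hγ⟩ := hK a ha
    refine ⟨DivisibleBy.div γ n, ?_⟩
    rw [← pow_left_inj₀ zero_le zero_le hn, hna, hγ, ← map_pow, ← ofAdd_nsmul,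
      DivisibleBy.div_cancel γ hn]
  have hνw : ∀ f, ν.val f ≤ w.comap (AdjoinRoot.mk F) f := fun f =>
    le_of_forall_lt fun c hc => by
      lift c to Γ using (hc.trans_le le_top).ne
      exact (hw _ _).mpr (hlt f c hc)
  refine ⟨⟨w.comap (AdjoinRoot.mk F), ValExtension.map_C_eq_of_le hνw⟩, ?_, hνw⟩
  ext f
  rw [AddValuation.mem_supp_iff]
  change w (AdjoinRoot.mk F f) = ⊤ ↔ _
  rw [AddValuation.top_iff, AdjoinRoot.mk_eq_zero, Ideal.mem_span_singleton]

end Extension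

theorem theorem1p1 {K Γ : Type*} [Field K] [AddCommGroup Γ] [LinearOrder Γ]
    [IsOrderedAddMonoid Γ] [DivisibleBy Γ ℕ] (ν₀ : AddValuation K (WithTop Γ))
    (F : K[X]) (hmonic : F.Monic) (hirr : Irreducible F)
    (ν : ValExtension ν₀) (hν : ¬ IsMax (ν : ValPoset ν₀)) :
    (ν : ValPoset ν₀) ∈ valuationsApproaching ν₀ F ↔ ¬ IsUnit (initialForm ν.val F) := by
  rw [isUnit_initialForm_iff]
  constructor
  · rintro ⟨_, ⟨μ, rfl, hμ⟩, hle⟩ ⟨g, hg⟩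
    have hle' : ν ≤ μ := WithBot.coe_le_coe.mp hle
    -- `1` is the sum of `1 - F * g` and `F * g`, both of positive `μ`-value.
    have h1 : 0 < μ.val (1 - F * g) := hg.trans_le (hle' _)
    have hF : μ.val F = ⊤ := by
      rw [← AddValuation.mem_supp_iff, hμ]
      exact Ideal.mem_span_singleton_self F
    have h2 : 0 < μ.val (F * g) := by
      rw [AddValuation.map_mul, hF, top_add]
      exact WithTop.coe_lt_top 0
    have := AddValuation.map_lt_add μ.val h1 h2
    rw [sub_add_cancel, AddValuation.map_one] at this
    exact this.false
  · intro h
    push Not at h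
    obtain ⟨μ, hμ, hle⟩ := ν.exists_le_supp_eq_span hirr h
    exact ⟨μ, ⟨μ, rfl, hμ⟩, WithBot.coe_le_coe.mpr hle⟩
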